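/- Let $n\ge 0$ be an integer, $W\in C^{2}(\mathbb{R}^{n};\mathbb{R})$ and $b\in\mathbb{R}^{n}$ with $W(b)=0$, $DW(b)=0$ and $D^{2}W(b)$ positive definite, and assume that the sets $\mathbb{D}=\{p\in\mathbb{R}^{n}: W(p)<0\}$ and $\Gamma=\partial\mathbb{D}$ are non-empty and bounded. Let $$\mathcal{A}=\left\{u\in H^{1}_{\mathrm{loc}}(\mathbb{R};\mathbb{R}^{n}) :\ \lim_{x\to+\infty}u(x)=b,\quad u(0)\in\Gamma,\quad W(u(x))\ge 0\ \text{for all } x>0\right\},$$ where $u\in H^{1}_{\mathrm{loc}}$ is identified with its continuous representative. For $c>0$ and $u\in\mathcal{A}$ let $$J(c,u)=\int_{\mathbb{R}}e^{cx}\left(\tfrac12|u'(x)|^{2}+W(u(x))\right)dx,\qquad \gamma(c)=\inf_{v\in\mathcal{A}}J(c,v),$$ where $u'$ is the weak derivative of $u$. Then for every $c>0$ the negative part of the integrand of $J(c,v)$ is integrable for every $v\in\mathcal{A}$, so that $J(c,v)\in(-\infty,+\infty]$ is well defined, and there exists $u\in\mathcal{A}$ such that the integrand of $J(c,u)$ is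 integrable and $$J(c,u)=\gamma(c).$$ In particular, $\gamma(c)$ is finite. -/

import Mathlib

open MeasureTheory Filter Set
open scoped Topology ContDiff ENNReal

noncomputable section

namespace TravelingWave

/-- The space `ℝⁿ` with its Euclidean norm. -/
abbrev Vec (n : ℕ) : Type := EuclideanSpace ℝ (Fin n)

/-- `v` is a weak (distributional) derivative of `u : ℝ → ℝⁿ`: both are locally integrable and
`∫ φ' u = - ∫ φ v` for every smooth compactly supported scalar test function `φ`. -/
def IsWeakDeriv {n : ℕ} (u v : ℝ → Vec n) : Prop :=
  LocallyIntegrable u ∧ LocallyIntegrable v ∧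
    ∀ φ : ℝ → ℝ, ContDiff ℝ ∞ φ → HasCompactSupport φ →
      ∫ x, deriv φ x • u x = - ∫ x, φ x • v x

/-- Weak derivatives are unique up to null sets, so `weakDeriv` below is well defined a.e. -/
theorem IsWeakDeriv.ae_eq {n : ℕ} {u v w : ℝ → Vec n} (hv : IsWeakDeriv u v)
    (hw : IsWeakDeriv u w) : v =ᵐ[volume] w :=
  ae_eq_of_integral_contDiff_smul_eq hv.2.1 hw.2.1 fun φ hφ hc =>
    neg_injective ((hv.2.2 φ hφ hc).symm.trans (hw.2.2 φ hφ hc))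

open Classical in
/-- The weak derivative of `u` (unique almost everywhere); zero if there is none. -/
def weakDeriv {n : ℕ} (u : ℝ → Vec n) : ℝ → Vec n :=
  if h : ∃ v, IsWeakDeriv u v then h.choose else 0

/-- `u ∈ L²_loc(ℝ; ℝⁿ)`. -/
def MemL2Loc {n : ℕ} (u : ℝ → Vec n) : Prop :=
  ∀ K : Set ℝ, IsCompact K → MemLp u 2 (volume.restrict K)

/-- `u ∈ H¹_loc(ℝ; ℝⁿ)`: `u` lies in `L²_loc` and has a weak derivative in `L²_loc`. -/
def MemH1Loc {n : ℕ} (u : ℝ → Vec n) : Prop :=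
  MemL2Loc u ∧ ∃ v, IsWeakDeriv u v ∧ MemL2Loc v

/-- The set `𝔻 = {W < 0}`. -/
def negSet {n : ℕ} (W : Vec n → ℝ) : Set (Vec n) := {p | W p < 0}

/-- The set `Γ = ∂𝔻`. -/
def Gam {n : ℕ} (W : Vec n → ℝ) : Set (Vec n) := frontier (negSet W)

/-- The standing assumption on the potential `W` and the point `b`. -/
structure Assumption {n : ℕ} (W : Vec n → ℝ) (b : Vec n) : Prop where
  contDiff : ContDiff ℝ 2 W
  value_eq_zero : W b = 0
  gradient_eq_zero : gradient W b = 0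
  hessian_pos : ∀ h : Vec n, h ≠ 0 → 0 < iteratedFDeriv ℝ 2 W b ![h, h]
  negSet_nonempty : (negSet W).Nonempty
  negSet_bounded : Bornology.IsBounded (negSet W)
  gam_nonempty : (Gam W).Nonempty
  gam_bounded : Bornology.IsBounded (Gam W)

/-- The admissible set `𝒜`: the functions `u ∈ H¹_loc(ℝ; ℝⁿ)`, identified with their continuous
representatives (every class in `H¹_loc(ℝ)` has exactly one), such that `u(+∞) = b`, `u(0) ∈ Γ`
and `W(u) ≥ 0` in `(0, ∞)`. -/
def admissible {n : ℕ} (W : Vec n → ℝ) (b : Vec n) : Set (ℝ → Vec n) :=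
  {u | MemH1Loc u ∧ Continuous u ∧ Tendsto u atTop (𝓝 b) ∧ u 0 ∈ Gam W ∧
    ∀ x : ℝ, 0 < x → 0 ≤ W (u x)}

/-- The integrand `e^{cx} (|u'|²/2 + W(u))` of the weighted functional. -/
def energyDensity {n : ℕ} (W : Vec n → ℝ) (c : ℝ) (u : ℝ → Vec n) (x : ℝ) : ℝ :=
  Real.exp (c * x) * (1 / 2 * ‖weakDeriv u x‖ ^ 2 + W (u x))

/-- The integral of the positive part of the integrand. -/
def posEnergy {n : ℕ} (W : Vec n → ℝ) (c : ℝ) (u : ℝ → Vec n) : ℝ≥0∞ :=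
  ∫⁻ x, ENNReal.ofReal (energyDensity W c u x)

/-- The integral of the negative part of the integrand. -/
def negEnergy {n : ℕ} (W : Vec n → ℝ) (c : ℝ) (u : ℝ → Vec n) : ℝ≥0∞ :=
  ∫⁻ x, ENNReal.ofReal (-energyDensity W c u x)

/-- `J(c, u) = ∫ e^{cx} (|u'|²/2 + W(u)) dx` as an extended real number: the integral of the
positive part minus that of the negative part. -/
def J {n : ℕ} (W : Vec n → ℝ) (c : ℝ) (u : ℝ → Vec n) : EReal :=
  (posEnergy W c u : EReal) - (negEnergy W c u : EReal)

/-- The minimum energy `γ(c) = inf_𝒜 J(c, ·)`. -/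
def minEnergy {n : ℕ} (W : Vec n → ℝ) (b : Vec n) (c : ℝ) : EReal :=
  ⨅ u ∈ admissible W b, J W c u

end TravelingWave

end

noncomputable section

namespace TravelingWave

/-! The proof is the direct method. `W` is negative only on a bounded set, so `W ≥ -M`, and `W(u) ≥
0` for `x > 0`. Adding `M e^{cx}` on `x ≤ 0`, which is integrable because `c > 0`, makes the density
nonnegative and changes `J` by a finite constant (`J_eq`).

Writing `u' = e^{-cs/2} g` turns the kinetic energy into `‖g‖²/2` in unweighted `L²`. Along a
minimizing sequence `g_k` is bounded and `u_k(0)` lies in the compact set `Γ`, so a subsequence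
satisfies `u_k(0) → p` and `g_k ⇀ g'`. Testing against truncations of `e^{-cs/2}` gives pointwise
convergence of `u_k` to the primitive of `e^{-cs/2} g'` starting at `p`. The conditions at `0` and
on `x > 0` are closed under this convergence. The condition at `+∞` survives because Cauchy–Schwarz
gives the uniform bound `|b - u_k(x)|² ≤ e^{-cx} ‖g_k‖² / c`. Weak lower semicontinuity of the norm
and Fatou's lemma for the potential show that the limit is a minimizer
(`exists_isMinOn_shiftedEnergy`). A path along a segment from `Γ` to `b` shows that the infimum is
finite. -/

/-! ### Weak derivatives on the line and their primitives -/

theorem intervalIntegrable_of_locallyIntegrable {E : Type*} [NormedAddCommGroup E] {f : ℝ → E}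
    (hf : LocallyIntegrable f) (a b : ℝ) : IntervalIntegrable f volume a b :=
  intervalIntegrable_iff.2 <|
    (hf.integrableOn_isCompact isCompact_uIcc).mono_set uIoc_subset_uIcc

/-- Integration by parts of a primitive against a smooth compactly supported function. -/
theorem integral_deriv_mul_primitive {f φ : ℝ → ℝ} (hf : LocallyIntegrable f) (p : ℝ)
    (hφ : ContDiff ℝ ∞ φ) (hc : HasCompactSupport φ) :
    ∫ x, deriv φ x * (p + ∫ s in (0 : ℝ)..x, f s) = - ∫ x, φ x * f x := by
  obtain ⟨R, hR0, hR⟩ : ∃ R : ℝ, 0 < R ∧ tsupport φ ⊆ Ioo (-R) R := by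
    obtain ⟨R, hR0, hR⟩ := hc.isCompact.isBounded.subset_ball_lt 0 0
    exact ⟨R, hR0, by simpa [Real.ball_eq_Ioo] using hR⟩
  have hz : ∀ x, x ∉ Ioo (-R) R → φ x = 0 := fun x hx =>
    image_eq_zero_of_notMem_tsupport fun h => hx (hR h)
  have hz' : ∀ x, x ∉ Ioo (-R) R → deriv φ x = 0 := fun x hx =>
    image_eq_zero_of_notMem_tsupport fun h => hx (hR (tsupport_deriv_subset h))
  have hcut : ∀ h : ℝ → ℝ, (∀ x, x ∉ Ioo (-R) R → h x = 0) →
      ∫ x, h x = ∫ x in (-R)..R, h x := fun h hh => by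
    rw [intervalIntegral.integral_of_le (by linarith),
      setIntegral_eq_integral_of_forall_compl_eq_zero]
    exact fun x hx => hh x fun h => hx ⟨h.1, h.2.le⟩
  have hfi : IntervalIntegrable f volume (-R) R := intervalIntegrable_of_locallyIntegrable hf _ _
  have hac : AbsolutelyContinuousOnInterval (fun x => ∫ s in (0 : ℝ)..x, f s) (-R) R :=
    hfi.absolutelyContinuousOnInterval_intervalIntegral (by
      rw [uIcc_of_le (by linarith)]; constructor <;> linarith)
  have hac' : AbsolutelyContinuousOnInterval (fun x => p + ∫ s in (0 : ℝ)..x, f s) (-R) R := by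
    have hcst : AbsolutelyContinuousOnInterval (fun _ : ℝ => p) (-R) R :=
      ContDiffOn.absolutelyContinuousOnInterval contDiffOn_const
    exact hcst.add hac
  have hφac : AbsolutelyContinuousOnInterval φ (-R) R :=
    (contDiff_infty.1 hφ 1).contDiffOn.absolutelyContinuousOnInterval
  have key := hφac.integral_mul_deriv_eq_deriv_mul hac'
  -- The support lies in the open interval, so both boundary terms vanish.
  rw [hz R (by simp), hz (-R) (by simp)] at key
  rw [hcut _ fun x hx => by rw [hz' x hx, zero_mul], hcut _ fun x hx => by rw [hz x hx, zero_mul]]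
  have hd : ∫ x in (-R)..R, φ x * deriv (fun x => p + ∫ s in (0 : ℝ)..x, f s) x
      = ∫ x in (-R)..R, φ x * f x := by
    refine intervalIntegral.integral_congr_ae ?_
    filter_upwards [_root_.LocallyIntegrable.ae_hasDerivAt_integral hf] with x hx _
    rw [((hx 0).const_add p).deriv]
  rw [← hd, key]
  ring

theorem locallyIntegrable_apply {n : ℕ} {v : ℝ → Vec n} (hv : LocallyIntegrable v) (i : Fin n) :
    LocallyIntegrable fun x => v x i := by
  rw [locallyIntegrable_iff] at hv ⊢
  exact fun K hK => (EuclideanSpace.proj (𝕜 := ℝ) i).integrable_comp (hv K hK)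

theorem integral_apply {n : ℕ} {μ : Measure ℝ} {v : ℝ → Vec n} (hv : Integrable v μ) (i : Fin n) :
    (∫ x, v x ∂μ) i = ∫ x, v x i ∂μ :=
  ((EuclideanSpace.proj (𝕜 := ℝ) i).integral_comp_comm hv).symm

theorem intervalIntegral_apply {n : ℕ} {v : ℝ → Vec n} (hv : LocallyIntegrable v) (a b : ℝ)
    (i : Fin n) : (∫ x in a..b, v x) i = ∫ x in a..b, v x i :=
  ((EuclideanSpace.proj (𝕜 := ℝ) i).intervalIntegral_comp_comm 
    (intervalIntegrable_of_locallyIntegrable hv _ _)).symm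

theorem continuous_primitive {n : ℕ} {v : ℝ → Vec n} (hv : LocallyIntegrable v) (p : Vec n) :
    Continuous fun x => p + ∫ s in (0 : ℝ)..x, v s :=
  continuous_const.add <|
    intervalIntegral.continuous_primitive (intervalIntegrable_of_locallyIntegrable hv) 0

/-- A primitive of a locally integrable function has that function as its weak derivative. -/
theorem isWeakDeriv_primitive {n : ℕ} {v : ℝ → Vec n} (hv : LocallyIntegrable v) (p : Vec n) :
    IsWeakDeriv (fun x => p + ∫ s in (0 : ℝ)..x, v s) v := by
  have hcont := continuous_primitive hv p
  refine ⟨hcont.locallyIntegrable, hv, fun φ hφ hc => ?_⟩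
  have hdφ : Continuous (deriv φ) := hφ.continuous_deriv (by simp)
  have h1 : Integrable fun x => deriv φ x • (p + ∫ s in (0 : ℝ)..x, v s) :=
    (hdφ.smul hcont).integrable_of_hasCompactSupport (hc.deriv.smul_right)
  have h2 : Integrable fun x => φ x • v x :=
    hv.integrable_smul_left_of_hasCompactSupport hφ.continuous hc
  ext i
  rw [integral_apply h1, PiLp.neg_apply, integral_apply h2]
  simpa only [PiLp.smul_apply, PiLp.add_apply, intervalIntegral_apply hv, smul_eq_mul] using
    integral_deriv_mul_primitive (locallyIntegrable_apply hv i) (p i) hφ hc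

/-- A smooth compactly supported function of zero integral is the derivative of such a function. -/
theorem exists_deriv_eq_of_integral_eq_zero {θ : ℝ → ℝ} (hθ : ContDiff ℝ ∞ θ)
    (hc : HasCompactSupport θ) (h0 : ∫ x, θ x = 0) :
    ∃ ψ : ℝ → ℝ, ContDiff ℝ ∞ ψ ∧ HasCompactSupport ψ ∧ deriv ψ = θ := by
  obtain ⟨R, hR0, hR⟩ : ∃ R : ℝ, 0 < R ∧ tsupport θ ⊆ Ioo (-R) R := by
    obtain ⟨R, hR0, hR⟩ := hc.isCompact.isBounded.subset_ball_lt 0 0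
    exact ⟨R, hR0, by simpa [Real.ball_eq_Ioo] using hR⟩
  have hz : ∀ x, x ∉ Ioo (-R) R → θ x = 0 := fun x hx =>
    image_eq_zero_of_notMem_tsupport fun h => hx (hR h)
  have hder : ∀ x, HasDerivAt (fun x => ∫ s in (-R)..x, θ s) (θ x) x := fun x =>
    (hθ.continuous.integral_hasStrictDerivAt _ x).hasDerivAt
  have hd : deriv (fun x => ∫ s in (-R)..x, θ s) = θ := funext fun x => (hder x).deriv
  refine ⟨fun x => ∫ s in (-R)..x, θ s, ?_, ?_, hd⟩
  · rw [contDiff_infty_iff_deriv, hd]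
    exact ⟨fun x => (hder x).differentiableAt, hθ⟩
  · refine HasCompactSupport.intro (isCompact_Icc (a := -R) (b := R)) fun x hx => ?_
    simp only [mem_Icc, not_and_or, not_le] at hx
    rcases hx with hx | hx
    · rw [intervalIntegral.integral_symm, intervalIntegral.integral_of_le hx.le, neg_eq_zero]
      refine setIntegral_eq_zero_of_forall_eq_zero fun s hs => hz s fun h => ?_
      exact absurd hs.2 (not_le.2 h.1)
    · rw [intervalIntegral.integral_of_le (by linarith),
        setIntegral_eq_integral_of_forall_compl_eq_zero, h0]
      exact fun s hs => hz s fun h => hs ⟨h.1, by linarith [h.2]⟩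

/-- **du Bois-Reymond lemma**: a continuous function with vanishing weak derivative is constant. -/
theorem eq_const_of_integral_deriv_smul_eq_zero {n : ℕ} {w : ℝ → Vec n} (hw : Continuous w)
    (h : ∀ φ : ℝ → ℝ, ContDiff ℝ ∞ φ → HasCompactSupport φ → ∫ x, deriv φ x • w x = 0) :
    ∃ C : Vec n, ∀ x, w x = C := by
  let η : ContDiffBump (0 : ℝ) := default
  have hη : ContDiff ℝ ∞ (η.normed volume) := η.contDiff_normed
  have hηc : HasCompactSupport (η.normed volume) := η.hasCompactSupport_normed
  have hη1 : ∫ x, η.normed volume x = 1 := η.integral_normed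
  have hint : ∀ φ : ℝ → ℝ, ContDiff ℝ ∞ φ → HasCompactSupport φ →
      Integrable fun x => φ x • w x := fun φ hφ hc =>
    (hφ.continuous.smul hw).integrable_of_hasCompactSupport hc.smul_right
  refine ⟨∫ x, η.normed volume x • w x, fun x => ?_⟩
  have hae : w =ᵐ[volume] fun _ => ∫ x, η.normed volume x • w x := by
    refine ae_eq_of_integral_contDiff_smul_eq hw.locallyIntegrable
      continuous_const.locallyIntegrable fun φ hφ hc => ?_
    have hφi : Integrable φ := hφ.continuous.integrable_of_hasCompactSupport hc
    have hηi : Integrable (η.normed volume) := hη.continuous.integrable_of_hasCompactSupport hηc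
    -- Subtracting the right multiple of the unit-mass bump gives `φ` zero integral, so the
    -- difference is the derivative of a test function.
    have hcs : HasCompactSupport fun x => φ x - (∫ y, φ y) * η.normed volume x :=
      hc.sub hηc.mul_left
    obtain ⟨ψ, hψ, hψc, hψd⟩ := exists_deriv_eq_of_integral_eq_zero
      (θ := fun x => φ x - (∫ y, φ y) * η.normed volume x)
      (hφ.sub (contDiff_const.mul hη)) hcs (by
        rw [integral_sub hφi (hηi.const_mul _), integral_const_mul, hη1]; ring)
    have := h ψ hψ hψc
    simp only [hψd, sub_smul, mul_smul] at this
    rw [integral_sub (hint φ hφ hc) ((hint _ hη hηc).fun_smul _), integral_smul, sub_eq_zero] at this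
    rw [this, integral_smul_const]
  exact congrFun (hw.ae_eq_iff_eq volume continuous_const |>.1 hae) x

/-- The fundamental theorem of calculus for weak derivatives. -/
theorem IsWeakDeriv.sub_eq_integral {n : ℕ} {u v : ℝ → Vec n} (h : IsWeakDeriv u v)
    (hu : Continuous u) (x y : ℝ) : u y - u x = ∫ s in x..y, v s := by
  have hv := h.2.1
  have hP := isWeakDeriv_primitive hv 0
  have hPc := continuous_primitive hv 0
  -- `u` and the primitive of `v` have the same weak derivative, so they differ by a constant.
  obtain ⟨C, hC⟩ := eq_const_of_integral_deriv_smul_eq_zero (hu.sub hPc) fun φ hφ hc => by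
    have hdφ : Continuous (deriv φ) := hφ.continuous_deriv (by simp)
    simp only [Pi.sub_apply, smul_sub]
    rw [integral_sub, h.2.2 φ hφ hc, hP.2.2 φ hφ hc, sub_self]
    · exact (hdφ.smul hu).integrable_of_hasCompactSupport hc.deriv.smul_right
    · exact (hdφ.smul hPc).integrable_of_hasCompactSupport hc.deriv.smul_right
  have hx := hC x
  have hy := hC y
  have hsub := intervalIntegral.integral_interval_sub_left (μ := volume) (f := v)
    (intervalIntegrable_of_locallyIntegrable hv 0 y)
    (intervalIntegrable_of_locallyIntegrable hv 0 x)
  simp only [Pi.sub_apply, zero_add] at hx hy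
  clear hC
  rw [← hsub, sub_eq_iff_eq_add.1 hx, sub_eq_iff_eq_add.1 hy]
  abel

theorem MemL2Loc.locallyIntegrable {n : ℕ} {v : ℝ → Vec n} (hv : MemL2Loc v) :
    LocallyIntegrable v :=
  locallyIntegrable_iff.2 fun K hK =>
    have : IsFiniteMeasure (volume.restrict K) :=
      isFiniteMeasure_restrict.2 hK.measure_lt_top.ne
    (hv K hK).integrable (by norm_num)

theorem _root_.Continuous.memL2Loc {n : ℕ} {u : ℝ → Vec n} (hu : Continuous u) : MemL2Loc u :=
  fun K hK => by
    rw [memLp_two_iff_integrable_sq_norm hu.aestronglyMeasurable]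
    exact (hu.norm.pow 2).continuousOn.integrableOn_compact hK

theorem isWeakDeriv_weakDeriv {n : ℕ} {u v : ℝ → Vec n} (h : IsWeakDeriv u v) :
    IsWeakDeriv u (weakDeriv u) := by
  have hex : ∃ v, IsWeakDeriv u v := ⟨v, h⟩
  rw [weakDeriv, dif_pos hex]
  exact hex.choose_spec

theorem IsWeakDeriv.weakDeriv_ae_eq {n : ℕ} {u v : ℝ → Vec n} (h : IsWeakDeriv u v) :
    weakDeriv u =ᵐ[volume] v :=
  (isWeakDeriv_weakDeriv h).ae_eq h

theorem MemH1Loc.isWeakDeriv {n : ℕ} {u : ℝ → Vec n} (h : MemH1Loc u) :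
    IsWeakDeriv u (weakDeriv u) :=
  isWeakDeriv_weakDeriv h.2.choose_spec.1

/-- Primitives of `L²_loc` functions lie in `H¹_loc`. -/
theorem memH1Loc_primitive {n : ℕ} {v : ℝ → Vec n} (hv : MemL2Loc v) (p : Vec n) :
    MemH1Loc fun x => p + ∫ s in (0 : ℝ)..x, v s :=
  ⟨(continuous_primitive hv.locallyIntegrable p).memL2Loc, v,
    isWeakDeriv_primitive hv.locallyIntegrable p, hv⟩

/-! ### Weak convergence in Hilbert space -/

/-- Bounded sequences in a separable Hilbert space have weakly convergent subsequences. -/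
theorem exists_subseq_tendsto_inner {H : Type*} [NormedAddCommGroup H] [InnerProductSpace ℝ H]
    [CompleteSpace H] [TopologicalSpace.SeparableSpace H] {x : ℕ → H} {R : ℝ}
    (hx : ∀ k, ‖x k‖ ≤ R) :
    ∃ (y : H) (φ : ℕ → ℕ), StrictMono φ ∧
      ∀ z, Tendsto (fun k => inner ℝ z (x (φ k))) atTop (𝓝 (inner ℝ z y)) := by
  -- Sequential Banach–Alaoglu in the dual, transported by the Riesz isometry.
  obtain ⟨l, -, φ, hφ, hl⟩ := WeakDual.isSeqCompact_closedBall ℝ H 0 R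
    (x := fun k => StrongDual.toWeakDual (InnerProductSpace.toDual ℝ H (x k))) (fun k => by
      simpa using hx k)
  refine ⟨(InnerProductSpace.toDual ℝ H).symm (WeakDual.toStrongDual l), φ, hφ, fun z => ?_⟩
  have h := ((WeakDual.eval_continuous z).tendsto l).comp hl
  have e : inner ℝ z ((InnerProductSpace.toDual ℝ H).symm (WeakDual.toStrongDual l)) = l z := by
    rw [real_inner_comm, InnerProductSpace.toDual_symm_apply]; rfl
  rw [e]
  refine h.congr fun k => ?_
  rw [real_inner_comm]; rfl

/-- The norm is weakly lower semicontinuous. -/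
theorem norm_le_of_tendsto_inner {H : Type*} [NormedAddCommGroup H] [InnerProductSpace ℝ H]
    {x : ℕ → H} {y : H} {r : ℝ}
    (h : ∀ z, Tendsto (fun k => inner ℝ z (x k)) atTop (𝓝 (inner ℝ z y)))
    (hr : Tendsto (fun k => ‖x k‖) atTop (𝓝 r)) : ‖y‖ ≤ r := by
  have h1 : inner ℝ y y ≤ ‖y‖ * r :=
    le_of_tendsto_of_tendsto' (h y) (hr.const_mul _) fun k => real_inner_le_norm _ _
  rw [real_inner_self_eq_norm_mul_norm] at h1
  rcases (norm_nonneg y).eq_or_lt with h0 | h0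
  · rw [← h0]; exact ge_of_tendsto' hr fun k => norm_nonneg _
  · exact le_of_mul_le_mul_left h1 h0

/-! ### Exponentially weighted primitives of `L²` functions -/

variable {n : ℕ}

/-- The function `s ↦ e^{-cs/2} e` cut off to `(a, b]`. -/
def weightVec (c a b : ℝ) (e : Vec n) : ℝ → Vec n :=
  (Ioc a b).indicator fun s => Real.exp (-(c / 2) * s) • e

theorem norm_exp_smul_sq (c s : ℝ) (e : Vec n) :
    ‖Real.exp (-(c / 2) * s) • e‖ ^ 2 = Real.exp (-c * s) * ‖e‖ ^ 2 := by
  rw [norm_smul, mul_pow, Real.norm_eq_abs, Real.abs_exp, ← Real.exp_nat_mul]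
  congr 2
  push_cast
  ring

theorem norm_weightVec_sq (c a b : ℝ) (e : Vec n) (s : ℝ) :
    ‖weightVec c a b e s‖ ^ 2 = (Ioc a b).indicator (fun s => Real.exp (-c * s) * ‖e‖ ^ 2) s := by
  by_cases hs : s ∈ Ioc a b
  · simp only [weightVec, indicator_of_mem hs, norm_exp_smul_sq]
  · simp [weightVec, indicator_of_notMem hs]

theorem memLp_weightVec (c a b : ℝ) (e : Vec n) : MemLp (weightVec c a b e) 2 := by
  have hm : AEStronglyMeasurable (weightVec c a b e) :=
    (by fun_prop : Continuous fun s => Real.exp (-(c / 2) * s) • e).aestronglyMeasurable.indicator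
      measurableSet_Ioc
  rw [memLp_two_iff_integrable_sq_norm hm]
  simp only [norm_weightVec_sq]
  exact (by fun_prop : Continuous fun s => Real.exp (-c * s) * ‖e‖ ^ 2).integrableOn_Ioc
    |>.integrable_indicator measurableSet_Ioc

theorem norm_toLp_sq {f : ℝ → Vec n} (hf : MemLp f 2) : ‖hf.toLp f‖ ^ 2 = ∫ s, ‖f s‖ ^ 2 := by
  rw [← real_inner_self_eq_norm_sq, L2.inner_def]
  refine integral_congr_ae ?_
  filter_upwards [hf.coeFn_toLp] with s hs
  rw [hs, real_inner_self_eq_norm_sq]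

/-- The constant comes from the integral over the whole half line beyond `a`. Its independence of
the right endpoint later allows that endpoint to tend to `+∞`. -/
theorem norm_toLp_weightVec_sq_le {c : ℝ} (hc : 0 < c) (a b : ℝ) (e : Vec n) :
    ‖(memLp_weightVec c a b e).toLp _‖ ^ 2 ≤ Real.exp (-c * a) / c * ‖e‖ ^ 2 := by
  rw [norm_toLp_sq]
  simp only [norm_weightVec_sq]
  rw [integral_indicator measurableSet_Ioc, integral_mul_const]
  gcongr
  have hI := integrableOn_exp_mul_Ioi (neg_lt_zero.2 hc) a
  calc ∫ s in Ioc a b, Real.exp (-c * s) ≤ ∫ s in Ioi a, Real.exp (-c * s) :=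
        setIntegral_mono_set hI (Eventually.of_forall fun s => (Real.exp_pos _).le)
          Ioc_subset_Ioi_self.eventuallyLE
    _ = Real.exp (-c * a) / c := by
        rw [integral_exp_mul_Ioi (neg_lt_zero.2 hc), neg_div_neg_eq]

/-- Multiplication by `e^{-cs/2}` maps `L²` into `L²_loc`. -/
theorem memL2Loc_exp_smul (c : ℝ) {g : ℝ → Vec n} (hg : MemLp g 2) :
    MemL2Loc fun s => Real.exp (-(c / 2) * s) • g s := fun K hK => by
  have hm : AEStronglyMeasurable (fun s => Real.exp (-(c / 2) * s) • g s) :=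
    (by fun_prop : Continuous fun s => Real.exp (-(c / 2) * s)).aestronglyMeasurable.smul hg.1
  rw [memLp_two_iff_integrable_sq_norm hm.restrict]
  simp only [norm_exp_smul_sq]
  exact IntegrableOn.continuousOn_mul
    (by fun_prop : Continuous fun s => Real.exp (-c * s)).continuousOn
    ((memLp_two_iff_integrable_sq_norm hg.1).1 hg).integrableOn hK

/-- Increments of weighted primitives are thus continuous linear functionals of `g`, which makes
them accessible to weak convergence. -/
theorem inner_toLp_weightVec (c : ℝ) {a b : ℝ} (hab : a ≤ b) (e : Vec n)
    (g : Lp (Vec n) 2 (volume : Measure ℝ)) :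
    inner ℝ ((memLp_weightVec c a b e).toLp _) g =
      inner ℝ e (∫ s in a..b, Real.exp (-(c / 2) * s) • g s) := by
  have hl := (memL2Loc_exp_smul c (Lp.memLp g)).locallyIntegrable
  rw [L2.inner_def, intervalIntegral.integral_of_le hab,
    ← integral_inner ((hl.integrableOn_isCompact isCompact_Icc).mono_set Ioc_subset_Icc_self),
    ← integral_indicator measurableSet_Ioc]
  refine integral_congr_ae ?_
  filter_upwards [(memLp_weightVec c a b e).coeFn_toLp] with s hs
  rw [hs]
  by_cases h : s ∈ Ioc a b
  · simp only [weightVec, indicator_of_mem h, real_inner_smul_left, real_inner_smul_right]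
  · simp [weightVec, indicator_of_notMem h]

/-- Cauchy–Schwarz by duality: the integral `I` is paired with itself, and a factor `‖I‖²` is
cancelled. -/
theorem norm_integral_exp_smul_sq_le {c a b : ℝ} (hc : 0 < c) (hab : a ≤ b)
    (g : Lp (Vec n) 2 (volume : Measure ℝ)) :
    ‖∫ s in a..b, Real.exp (-(c / 2) * s) • g s‖ ^ 2 ≤ Real.exp (-c * a) / c * ‖g‖ ^ 2 := by
  set I := ∫ s in a..b, Real.exp (-(c / 2) * s) • g s with hI
  have h1 : ‖I‖ ^ 2 ≤ ‖(memLp_weightVec c a b I).toLp _‖ * ‖g‖ := by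
    rw [← real_inner_self_eq_norm_sq]
    nth_rw 2 [hI]
    rw [← inner_toLp_weightVec c hab]
    exact real_inner_le_norm _ _
  have h2 := norm_toLp_weightVec_sq_le hc a b I
  rcases (norm_nonneg I).eq_or_lt with h0 | h0
  · rw [← h0, zero_pow two_ne_zero]; positivity
  · have h3 : (‖I‖ ^ 2) ^ 2 ≤ (Real.exp (-c * a) / c * ‖I‖ ^ 2) * ‖g‖ ^ 2 := by
      refine (pow_le_pow_left₀ (by positivity) h1 2).trans ?_
      rw [mul_pow]
      gcongr
    have h4 : 0 < ‖I‖ ^ 2 := by positivity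
    refine le_of_mul_le_mul_left ?_ h4
    linarith

/-- Weak `L²` convergence implies convergence of the weighted primitives. -/
theorem tendsto_integral_exp_smul (c : ℝ) {g : ℕ → Lp (Vec n) 2 (volume : Measure ℝ)}
    {g' : Lp (Vec n) 2 (volume : Measure ℝ)}
    (h : ∀ z, Tendsto (fun k => inner ℝ z (g k)) atTop (𝓝 (inner ℝ z g'))) (a b : ℝ) :
    Tendsto (fun k => ∫ s in a..b, Real.exp (-(c / 2) * s) • g k s) atTop
      (𝓝 (∫ s in a..b, Real.exp (-(c / 2) * s) • g' s)) := by
  wlog hab : a ≤ b generalizing a b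
  · simpa only [intervalIntegral.integral_symm b a] using (this b a (le_of_not_ge hab)).neg
  -- In finite dimension it suffices to test against each coordinate vector.
  have hcoord : ∀ i, Tendsto (fun k => (∫ s in a..b, Real.exp (-(c / 2) * s) • g k s) i) atTop
      (𝓝 ((∫ s in a..b, Real.exp (-(c / 2) * s) • g' s) i)) := fun i => by
    simpa [inner_toLp_weightVec c hab, EuclideanSpace.inner_single_left] using
      h ((memLp_weightVec c a b (EuclideanSpace.single i 1)).toLp _)
  have h2 := (PiLp.continuous_toLp 2 _).continuousAt.tendsto.comp (tendsto_pi_nhds.2 hcoord)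
  simpa [Function.comp_def] using h2

/-! ### The potential and a competitor of finite energy -/

variable {W : Vec n → ℝ} {b : Vec n}

theorem Assumption.continuous (hW : Assumption W b) : Continuous W := hW.contDiff.continuous

/-- `W` is bounded below, since it is negative only on a bounded set. -/
theorem Assumption.exists_lower_bound (hW : Assumption W b) : ∃ M : ℝ, 0 ≤ M ∧ ∀ p, -M ≤ W p := by
  obtain ⟨m, hm⟩ := (hW.negSet_bounded.isCompact_closure.image hW.continuous).bddBelow
  refine ⟨max (-m) 0, le_max_right _ _, fun p => ?_⟩
  by_cases hp : W p < 0
  · have := hm (mem_image_of_mem W (subset_closure (show p ∈ negSet W from hp)))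
    linarith [le_max_left (-m) 0]
  · linarith [le_max_right (-m) 0, not_lt.1 hp]

theorem isCompact_gam (hW : Assumption W b) : IsCompact (Gam W) :=
  Metric.isCompact_of_isClosed_isBounded isClosed_frontier hW.gam_bounded

theorem mem_gam_iff (hW : Continuous W) {p : Vec n} :
    p ∈ Gam W ↔ p ∈ closure (negSet W) ∧ 0 ≤ W p := by
  have ho : IsOpen (negSet W) := isOpen_lt hW continuous_const
  rw [Gam, ho.frontier_eq, Set.mem_sdiff, negSet, mem_ofPred_eq, not_lt]

theorem eq_zero_of_mem_gam (hW : Continuous W) {p : Vec n} (hp : p ∈ Gam W) : W p = 0 := by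
  rw [mem_gam_iff hW] at hp
  exact le_antisymm (closure_lt_subset_le hW continuous_const hp.1) hp.2

/-- The last exit from `𝔻` of a segment ending at `b`. -/
theorem Assumption.exists_segment (hW : Assumption W b) :
    ∃ p ∈ Gam W, ∀ t ∈ Icc (0 : ℝ) 1, 0 ≤ W (p + t • (b - p)) := by
  obtain ⟨q, hq⟩ := hW.negSet_nonempty
  let γ : ℝ → Vec n := fun t => q + t • (b - q)
  have hγ : Continuous γ := by fun_prop
  have hcpt : IsCompact (Icc (0 : ℝ) 1 ∩ γ ⁻¹' closure (negSet W)) :=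
    isCompact_Icc.inter_right (isClosed_closure.preimage hγ)
  obtain ⟨t₀, ⟨ht₀, hγt₀⟩, hmax⟩ := hcpt.exists_isGreatest
    ⟨0, ⟨le_rfl, zero_le_one⟩, subset_closure (by simpa [γ] using hq)⟩
  have hpos : ∀ t ∈ Ioc t₀ 1, 0 ≤ W (γ t) := fun t ht => by
    by_contra hneg
    exact absurd (hmax ⟨⟨ht₀.1.trans ht.1.le, ht.2⟩, subset_closure (not_le.1 hneg)⟩)
      (not_le.2 ht.1)
  have hpos' : ∀ t ∈ Icc t₀ 1, 0 ≤ W (γ t) := by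
    -- If `t₀ = 1`, only the endpoint `b` remains, where `W` vanishes. Otherwise `t₀` is a limit of
    -- later times, and `W ≥ 0` is a closed condition.
    rcases ht₀.2.eq_or_lt with h1 | h1
    · intro t ht
      have : t = 1 := le_antisymm ht.2 (h1 ▸ ht.1)
      simp [γ, this, hW.value_eq_zero]
    · have hcl : IsClosed {t | 0 ≤ W (γ t)} :=
        isClosed_le continuous_const (hW.continuous.comp hγ)
      rw [← closure_Ioc h1.ne]
      exact fun t ht => closure_minimal hpos hcl ht
  refine ⟨γ t₀, (mem_gam_iff hW.continuous).2 ⟨hγt₀, hpos' _ ⟨le_rfl, ht₀.2⟩⟩, fun t ht => ?_⟩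
  have e : γ t₀ + t • (b - γ t₀) = γ (t₀ + t * (1 - t₀)) := by
    simp only [γ]
    module
  rw [e]
  refine hpos' _ ⟨?_, ?_⟩
  · nlinarith [ht.1, ht₀.2]
  · nlinarith [ht.2, ht₀.2]

theorem isWeakDeriv_deriv {u : ℝ → Vec n} (hu : ContDiff ℝ 1 u) : IsWeakDeriv u (deriv u) := by
  have hd := hu.continuous_deriv le_rfl
  have e : u = fun x => u 0 + ∫ s in (0 : ℝ)..x, deriv u s := funext fun x => by
    rw [intervalIntegral.integral_deriv_eq_sub
      (fun y _ => (hu.differentiable one_ne_zero).differentiableAt) (hd.intervalIntegrable _ _)]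
    abel
  have h := isWeakDeriv_primitive hd.locallyIntegrable (u 0)
  rwa [← e] at h

theorem aestronglyMeasurable_weakDeriv {u : ℝ → Vec n} (hu : MemH1Loc u) :
    AEStronglyMeasurable (weakDeriv u) :=
  hu.isWeakDeriv.2.1.aestronglyMeasurable

/-- Some admissible function has an integrable energy density. -/
theorem Assumption.exists_integrable (hW : Assumption W b) (c : ℝ) :
    ∃ u ∈ admissible W b, Integrable (energyDensity W c u) := by
  obtain ⟨p, hp, hseg⟩ := hW.exists_segment
  have hWp := eq_zero_of_mem_gam hW.continuous hp
  -- Constant outside `[0, 1]` with values `p` and `b`, both zeros of `W`, so the energy density has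
  -- compact support.
  let u : ℝ → Vec n := fun x => p + Real.smoothTransition x • (b - p)
  have hu : ContDiff ℝ 1 u :=
    contDiff_const.add (Real.smoothTransition.contDiff.smul contDiff_const)
  have hd := hu.continuous_deriv le_rfl
  have hlow : ∀ x ≤ 0, u x = p := fun x hx => by
    simp [u, Real.smoothTransition.zero_of_nonpos hx]
  have hhigh : ∀ x, 1 ≤ x → u x = b := fun x hx => by
    simp [u, Real.smoothTransition.one_of_one_le hx]
  have hw := isWeakDeriv_deriv hu
  refine ⟨u, ⟨⟨hu.continuous.memL2Loc, _, hw, hd.memL2Loc⟩, hu.continuous, ?_, ?_, ?_⟩, ?_⟩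
  · exact tendsto_const_nhds.congr' ((eventually_ge_atTop 1).mono fun x hx => (hhigh x hx).symm)
  · rwa [hlow 0 le_rfl]
  · exact fun x _ => hseg _ ⟨Real.smoothTransition.nonneg x, Real.smoothTransition.le_one x⟩
  · have hcont : Continuous fun x => Real.exp (c * x) * (1 / 2 * ‖deriv u x‖ ^ 2 + W (u x)) := by
      have := hW.continuous.comp hu.continuous
      exact (by fun_prop : Continuous fun x => Real.exp (c * x)).mul
        ((continuous_const.mul (hd.norm.pow 2)).add this)
    have hcs : HasCompactSupport
        fun x => Real.exp (c * x) * (1 / 2 * ‖deriv u x‖ ^ 2 + W (u x)) := by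
      refine HasCompactSupport.intro (isCompact_Icc (a := (0 : ℝ)) (b := 1)) fun x hx => ?_
      simp only [mem_Icc, not_and_or, not_le] at hx
      rcases hx with hx | hx
      · have : u =ᶠ[𝓝 x] fun _ => p := (eventually_lt_nhds hx).mono fun y hy => hlow y hy.le
        simp [this.deriv_eq, hlow x hx.le, hWp]
      · have : u =ᶠ[𝓝 x] fun _ => b := (eventually_gt_nhds hx).mono fun y hy => hhigh y hy.le
        simp [this.deriv_eq, hhigh x hx.le, hW.value_eq_zero]
    refine (hcont.integrable_of_hasCompactSupport hcs).congr ?_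
    filter_upwards [hw.weakDeriv_ae_eq] with x hx
    rw [energyDensity, hx]

/-! ### The shifted, nonnegative energy -/

/-- The integrable weight `M e^{cx}` on the negative half line. -/
def shift (c M : ℝ) : ℝ → ℝ := (Iic 0).indicator fun x => M * Real.exp (c * x)

theorem integrable_shift {c : ℝ} (hc : 0 < c) (M : ℝ) : Integrable (shift c M) :=
  IntegrableOn.integrable_indicator ((integrableOn_exp_mul_Iic hc 0).const_mul M) measurableSet_Iic

theorem shift_nonneg {c M : ℝ} (hM : 0 ≤ M) (x : ℝ) : 0 ≤ shift c M x :=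
  indicator_nonneg (fun _ _ => by positivity) x

/-- The weighted potential energy density, shifted to become nonnegative. -/
def potential (W : Vec n → ℝ) (c M : ℝ) (u : ℝ → Vec n) (x : ℝ) : ℝ :=
  Real.exp (c * x) * W (u x) + shift c M x

/-- The energy, shifted to become nonnegative. -/
def shiftedEnergy (W : Vec n → ℝ) (c M : ℝ) (u : ℝ → Vec n) : ℝ≥0∞ :=
  ∫⁻ x, ENNReal.ofReal (energyDensity W c u x + shift c M x)

theorem energyDensity_add_shift (c M : ℝ) (u : ℝ → Vec n) (x : ℝ) :
    energyDensity W c u x + shift c M x =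
      Real.exp (c * x) * (1 / 2 * ‖weakDeriv u x‖ ^ 2) + potential W c M u x := by
  rw [energyDensity, potential]
  ring

/-- On `x ≤ 0` the sum is `e^{cx} (W(u) + M)`; on `x > 0` admissibility replaces the lower bound on
`W`. -/
theorem potential_nonneg {c M : ℝ} (hM : 0 ≤ M) (hWM : ∀ p, -M ≤ W p) {u : ℝ → Vec n}
    (hu : ∀ x, 0 < x → 0 ≤ W (u x)) (x : ℝ) : 0 ≤ potential W c M u x := by
  rw [potential]
  by_cases hx : 0 < x
  · exact add_nonneg (mul_nonneg (Real.exp_pos _).le (hu x hx)) (shift_nonneg hM x)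
  · rw [shift, indicator_of_mem (show x ∈ Iic 0 from not_lt.1 hx)]
    nlinarith [Real.exp_pos (c * x), hWM (u x)]

theorem energyDensity_add_shift_nonneg {c M : ℝ} (hM : 0 ≤ M) (hWM : ∀ p, -M ≤ W p)
    {u : ℝ → Vec n} (hu : ∀ x, 0 < x → 0 ≤ W (u x)) (x : ℝ) :
    0 ≤ energyDensity W c u x + shift c M x := by
  rw [energyDensity_add_shift]
  exact add_nonneg (by positivity) (potential_nonneg hM hWM hu x)

theorem aestronglyMeasurable_potential (hW : Continuous W) {c : ℝ} (hc : 0 < c) (M : ℝ)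
    {u : ℝ → Vec n} (hu : Continuous u) : AEStronglyMeasurable (potential W c M u) :=
  (by fun_prop : Continuous fun x => Real.exp (c * x) * W (u x)).aestronglyMeasurable.add
    (integrable_shift hc M).1

theorem aestronglyMeasurable_energyDensity (hW : Continuous W) (c : ℝ) {u : ℝ → Vec n}
    (hu : MemH1Loc u) (huc : Continuous u) : AEStronglyMeasurable (energyDensity W c u) :=
  (by fun_prop : Continuous fun x => Real.exp (c * x)).aestronglyMeasurable.mul
    ((((aestronglyMeasurable_weakDeriv hu).norm.pow 2).const_mul (1 / 2)).add
      (hW.comp huc).aestronglyMeasurable)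

theorem negEnergy_lt_top {c M : ℝ} (hc : 0 < c) (hM : 0 ≤ M) (hWM : ∀ p, -M ≤ W p)
    {u : ℝ → Vec n} (hu : ∀ x, 0 < x → 0 ≤ W (u x)) : negEnergy W c u < ⊤ := by
  refine lt_of_le_of_lt (lintegral_mono fun x => ENNReal.ofReal_le_ofReal ?_)
    (integrable_shift hc M).lintegral_lt_top
  linarith [energyDensity_add_shift_nonneg (c := c) hM hWM hu x]

theorem integrable_energyDensity (hW : Continuous W) {c M : ℝ} (hc : 0 < c) (hM : 0 ≤ M)
    (hWM : ∀ p, -M ≤ W p) {u : ℝ → Vec n} (hu : u ∈ admissible W b)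
    (hE : shiftedEnergy W c M u < ⊤) : Integrable (energyDensity W c u) := by
  have hs := integrable_shift hc M
  have hi : Integrable fun x => energyDensity W c u x + shift c M x :=
    (lintegral_ofReal_ne_top_iff_integrable
      ((aestronglyMeasurable_energyDensity hW c hu.1 hu.2.1).add hs.1)
      (Eventually.of_forall (energyDensity_add_shift_nonneg hM hWM hu.2.2.2.2))).1 hE.ne
  exact (hi.sub hs).congr (Eventually.of_forall fun x => by simp)

/-- The functional `J` is the shifted energy minus a constant. -/
theorem J_eq (hW : Continuous W) {c M : ℝ} (hc : 0 < c) (hM : 0 ≤ M) (hWM : ∀ p, -M ≤ W p)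
    {u : ℝ → Vec n} (hu : u ∈ admissible W b) :
    J W c u = (shiftedEnergy W c M u : EReal) -
      ((∫⁻ x, ENNReal.ofReal (shift c M x) : ℝ≥0∞) : EReal) := by
  have hN := negEnergy_lt_top hc hM hWM hu.2.2.2.2
  have hs := integrable_shift hc M
  have hS := hs.lintegral_lt_top
  have hf := aestronglyMeasurable_energyDensity hW c hu.1 hu.2.1
  -- The additive form holds even when the energy is infinite. The shift and the negative part are
  -- finite, so it can be rearranged in `EReal`.
  have key : posEnergy W c u + ∫⁻ x, ENNReal.ofReal (shift c M x) =
      shiftedEnergy W c M u + negEnergy W c u := by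
    rw [posEnergy, shiftedEnergy, negEnergy, ← lintegral_add_left' hf.aemeasurable.ennreal_ofReal,
      ← lintegral_add_right' _ hf.aemeasurable.fun_neg.ennreal_ofReal]
    refine lintegral_congr fun x => ?_
    have h0 := energyDensity_add_shift_nonneg (c := c) hM hWM hu.2.2.2.2 x
    have h1 := shift_nonneg (c := c) hM x
    rcases le_total 0 (energyDensity W c u x) with h | h
    · rw [← ENNReal.ofReal_add h h1, ENNReal.ofReal_of_nonpos (neg_nonpos.2 h), add_zero]
    · rw [← ENNReal.ofReal_add h0 (neg_nonneg.2 h), ENNReal.ofReal_of_nonpos h, zero_add]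
      congr 1
      ring
  rw [J]
  generalize posEnergy W c u = P at *
  generalize negEnergy W c u = N at *
  generalize shiftedEnergy W c M u = F at *
  generalize (∫⁻ x, ENNReal.ofReal (shift c M x)) = S at *
  lift N to NNReal using hN.ne
  lift S to NNReal using hS.ne
  induction P with
  | top =>
    have : F = ⊤ := by
      by_contra h
      exact ENNReal.add_ne_top.2 ⟨h, ENNReal.coe_ne_top⟩ (by rw [← key]; simp)
    rw [this]
    rfl
  | coe P =>
    have hF : F ≠ ⊤ := by
      rintro rfl
      rw [top_add] at key
      exact ENNReal.add_ne_top.2 ⟨ENNReal.coe_ne_top, ENNReal.coe_ne_top⟩ key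
    lift F to NNReal using hF
    have key' : (P : ℝ) + S = F + N := by exact_mod_cast key
    change ((P : ℝ) : EReal) - ((N : ℝ) : EReal) = ((F : ℝ) : EReal) - ((S : ℝ) : EReal)
    rw [← EReal.coe_sub, ← EReal.coe_sub]
    congr 1
    linarith

theorem exp_mul_half_norm_exp_smul_sq (c s : ℝ) (e : Vec n) :
    Real.exp (c * s) * (1 / 2 * ‖Real.exp (-(c / 2) * s) • e‖ ^ 2) = 1 / 2 * ‖e‖ ^ 2 := by
  have h : Real.exp (c * s) * Real.exp (-c * s) = 1 := by
    rw [← Real.exp_add, neg_mul, add_neg_cancel, Real.exp_zero]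
  rw [norm_exp_smul_sq]
  linear_combination (1 / 2 * ‖e‖ ^ 2) * h

/-- The shifted energy in terms of the weighted derivative. -/
theorem shiftedEnergy_eq {c M : ℝ} (hM : 0 ≤ M) (hWM : ∀ p, -M ≤ W p)
    {u : ℝ → Vec n} (hu : ∀ x, 0 < x → 0 ≤ W (u x)) {g : Lp (Vec n) 2 (volume : Measure ℝ)}
    (hg : weakDeriv u =ᵐ[volume] fun s => Real.exp (-(c / 2) * s) • g s) :
    shiftedEnergy W c M u =
      ENNReal.ofReal (1 / 2 * ‖g‖ ^ 2) + ∫⁻ x, ENNReal.ofReal (potential W c M u x) := by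
  have hgi := (memLp_two_iff_integrable_sq_norm (Lp.memLp g).1).1 (Lp.memLp g)
  have hn : ‖g‖ ^ 2 = ∫ s, ‖g s‖ ^ 2 := by
    rw [← norm_toLp_sq (Lp.memLp g), Lp.toLp_coeFn]
  rw [hn, ← integral_const_mul, ofReal_integral_eq_lintegral_ofReal (hgi.const_mul _)
    (Eventually.of_forall fun s => by positivity),
    ← lintegral_add_left' (hgi.const_mul _).1.aemeasurable.ennreal_ofReal]
  refine lintegral_congr_ae ?_
  filter_upwards [hg] with x hx
  rw [energyDensity_add_shift, hx, exp_mul_half_norm_exp_smul_sq,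
    ENNReal.ofReal_add (by positivity) (potential_nonneg hM hWM hu x)]

/-- Functions of finite energy have a square integrable weighted derivative. -/
theorem exists_weighted_deriv {c M : ℝ} (hM : 0 ≤ M) (hWM : ∀ p, -M ≤ W p)
    {u : ℝ → Vec n} (hu : u ∈ admissible W b) (hE : shiftedEnergy W c M u < ⊤) :
    ∃ g : Lp (Vec n) 2 (volume : Measure ℝ),
      weakDeriv u =ᵐ[volume] fun s => Real.exp (-(c / 2) * s) • g s := by
  have hv := aestronglyMeasurable_weakDeriv hu.1
  have hexp : ∀ s, Real.exp (-(c / 2) * s) • Real.exp (c / 2 * s) • weakDeriv u s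
      = weakDeriv u s := fun s => by
    rw [smul_smul, ← Real.exp_add, neg_mul, neg_add_cancel, Real.exp_zero, one_smul]
  have hm : AEStronglyMeasurable fun s => Real.exp (c / 2 * s) • weakDeriv u s :=
    (by fun_prop : Continuous fun s => Real.exp (c / 2 * s)).aestronglyMeasurable.smul hv
  have hL : MemLp (fun s => Real.exp (c / 2 * s) • weakDeriv u s) 2 := by
    rw [memLp_two_iff_integrable_sq_norm hm]
    have hi : Integrable fun s => 1 / 2 * ‖Real.exp (c / 2 * s) • weakDeriv u s‖ ^ 2 := by
      refine (lintegral_ofReal_ne_top_iff_integrable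
        (f := fun s => 1 / 2 * ‖Real.exp (c / 2 * s) • weakDeriv u s‖ ^ 2)
        ((hm.norm.pow 2).const_mul _) (Eventually.of_forall fun s => by positivity)).1 (lt_of_le_of_lt ?_ hE).ne
      refine lintegral_mono fun s => ENNReal.ofReal_le_ofReal ?_
      rw [energyDensity_add_shift,
        ← exp_mul_half_norm_exp_smul_sq c s (Real.exp (c / 2 * s) • weakDeriv u s), hexp]
      exact le_add_of_nonneg_right (potential_nonneg hM hWM hu.2.2.2.2 s)
    exact (hi.const_mul 2).congr (Eventually.of_forall fun s => by ring)
  refine ⟨hL.toLp _, ?_⟩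
  filter_upwards [hL.coeFn_toLp] with s hs
  rw [hs, hexp]

theorem sub_eq_integral_exp_smul {c : ℝ} {u : ℝ → Vec n} (hu : u ∈ admissible W b)
    {g : Lp (Vec n) 2 (volume : Measure ℝ)}
    (hg : weakDeriv u =ᵐ[volume] fun s => Real.exp (-(c / 2) * s) • g s) (x y : ℝ) :
    u y - u x = ∫ s in x..y, Real.exp (-(c / 2) * s) • g s := by
  rw [hu.1.isWeakDeriv.sub_eq_integral hu.2.1 x y]
  exact intervalIntegral.integral_congr_ae (hg.mono fun s hs _ => hs)

/-- Exponential decay to `b` of functions of finite energy. -/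
theorem norm_sub_sq_le {c : ℝ} (hc : 0 < c) {u : ℝ → Vec n} (hu : u ∈ admissible W b)
    {g : Lp (Vec n) 2 (volume : Measure ℝ)}
    (hg : weakDeriv u =ᵐ[volume] fun s => Real.exp (-(c / 2) * s) • g s) (x : ℝ) :
    ‖b - u x‖ ^ 2 ≤ Real.exp (-c * x) / c * ‖g‖ ^ 2 := by
  refine le_of_tendsto (((hu.2.2.1.sub_const (u x)).norm).pow 2) ?_
  -- The bound on `[x, y]` does not depend on `y`, and `u y → b`.
  filter_upwards [eventually_ge_atTop x] with y hy
  rw [sub_eq_integral_exp_smul hu hg]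
  exact norm_integral_exp_smul_sq_le hc hy g

/-! ### Compactness and existence of a minimizer -/

/-- Sequences of bounded energy have subsequences along which the initial values, the norms of the
weighted derivatives and, weakly, the weighted derivatives themselves converge. -/
theorem exists_subseq_tendsto (hW : Assumption W b) {p : ℕ → Vec n} (hp : ∀ k, p k ∈ Gam W)
    {g : ℕ → Lp (Vec n) 2 (volume : Measure ℝ)} {R : ℝ} (hR : ∀ k, ‖g k‖ ≤ R) :
    ∃ (φ : ℕ → ℕ) (p' : Vec n) (r : ℝ) (g' : Lp (Vec n) 2 (volume : Measure ℝ)),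
      StrictMono φ ∧ p' ∈ Gam W ∧ Tendsto (p ∘ φ) atTop (𝓝 p') ∧
      Tendsto (fun k => ‖g (φ k)‖) atTop (𝓝 r) ∧
      ∀ z, Tendsto (fun k => inner ℝ z (g (φ k))) atTop (𝓝 (inner ℝ z g')) := by
  obtain ⟨⟨p', r⟩, hmem, φ, hφ, hlim⟩ := ((isCompact_gam hW).prod
    (isCompact_Icc (a := (0 : ℝ)) (b := R))).tendsto_subseq (x := fun k => (p k, ‖g k‖))
    fun k => ⟨hp k, norm_nonneg _, hR k⟩
  -- Needed for the separability of `L²`.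
  have : Fact ((2 : ℝ≥0∞) ≠ ⊤) := ⟨by norm_num⟩
  obtain ⟨g', ψ, hψ, hg'⟩ := exists_subseq_tendsto_inner fun k => hR (φ k)
  rw [nhds_prod_eq] at hlim
  exact ⟨φ ∘ ψ, p', r, g', hφ.comp hψ, hmem.1,
    (tendsto_fst.comp hlim).comp hψ.tendsto_atTop,
    (tendsto_snd.comp hlim).comp hψ.tendsto_atTop, hg'⟩

/-- The shifted energy attains its infimum over the admissible set. -/
theorem exists_isMinOn_shiftedEnergy (hW : Assumption W b) {c M : ℝ} (hc : 0 < c) (hM : 0 ≤ M)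
    (hWM : ∀ p, -M ≤ W p) :
    ∃ u ∈ admissible W b, shiftedEnergy W c M u < ⊤ ∧
      ∀ v ∈ admissible W b, shiftedEnergy W c M u ≤ shiftedEnergy W c M v := by
  obtain ⟨u₀, hu₀, hi₀⟩ := hW.exists_integrable c
  have hfin : shiftedEnergy W c M u₀ < ⊤ := (hi₀.add (integrable_shift hc M)).lintegral_lt_top
  set m := sInf (shiftedEnergy W c M '' admissible W b) with hm
  have hmle : ∀ v ∈ admissible W b, m ≤ shiftedEnergy W c M v := fun v hv =>
    sInf_le (mem_image_of_mem _ hv)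
  have hmtop : m < ⊤ := (hmle u₀ hu₀).trans_lt hfin
  obtain ⟨F, -, hF, hFmem⟩ := exists_seq_tendsto_sInf
    (⟨_, mem_image_of_mem (shiftedEnergy W c M) hu₀⟩ :
      (shiftedEnergy W c M '' admissible W b).Nonempty) (OrderBot.bddBelow _)
  rw [← hm] at hF
  -- Dropping the first `N` terms bounds all the energies by `m + 1`.
  obtain ⟨N, hN⟩ := eventually_atTop.1 (hF.eventually_lt_const
    (ENNReal.lt_add_right hmtop.ne one_ne_zero))
  choose u hu huF using fun k => hFmem (k + N)
  have hlim : Tendsto (fun k => shiftedEnergy W c M (u k)) atTop (𝓝 m) := by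
    simpa only [huF, Function.comp_def] using hF.comp (tendsto_add_atTop_nat N)
  have hbound : ∀ k, shiftedEnergy W c M (u k) ≤ m + 1 := fun k => by
    rw [huF]; exact (hN _ (Nat.le_add_left N k)).le
  have hm1 : m + 1 < ⊤ := ENNReal.add_lt_top.2 ⟨hmtop, ENNReal.one_lt_top⟩
  choose g hg using fun k => exists_weighted_deriv hM hWM (hu k) ((hbound k).trans_lt hm1)
  have hE := fun k => shiftedEnergy_eq hM hWM (hu k).2.2.2.2 (hg k)
  have hgR : ∀ k, ‖g k‖ ^ 2 ≤ 2 * (m + 1).toReal := fun k => by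
    have h1 : ENNReal.ofReal (1 / 2 * ‖g k‖ ^ 2) ≤ m + 1 :=
      (le_self_add.trans (hE k).ge).trans (hbound k)
    have h2 := (ENNReal.ofReal_le_iff_le_toReal hm1.ne).1 h1
    linarith
  obtain ⟨φ, p, r, g', hφ, hp, hup, hgr, hgw⟩ := exists_subseq_tendsto hW
    (fun k => (hu k).2.2.2.1) (fun k => Real.le_sqrt_of_sq_le (hgR k))
  have hL := memL2Loc_exp_smul c (Lp.memLp g')
  let u' : ℝ → Vec n := fun x => p + ∫ s in (0 : ℝ)..x, Real.exp (-(c / 2) * s) • g' s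
  have hpt : ∀ x, Tendsto (fun k => u (φ k) x) atTop (𝓝 (u' x)) := fun x => by
    refine (hup.add (tendsto_integral_exp_smul c hgw 0 x)).congr fun k => ?_
    rw [← sub_eq_integral_exp_smul (hu (φ k)) (hg (φ k))]
    simp
  have hWpt : ∀ x, Tendsto (fun k => W (u (φ k) x)) atTop (𝓝 (W (u' x))) := fun x =>
    (hW.continuous.tendsto _).comp (hpt x)
  have hwd := isWeakDeriv_primitive hL.locallyIntegrable p
  -- The decay bound is uniform in `k`, so the pointwise limit inherits it.
  have hdecay : ∀ x, ‖b - u' x‖ ^ 2 ≤ Real.exp (-c * x) / c * (2 * (m + 1).toReal) := fun x => by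
    refine le_of_tendsto' (((tendsto_const_nhds.sub (hpt x)).norm).pow 2) fun k => ?_
    refine (norm_sub_sq_le hc (hu (φ k)) (hg (φ k)) x).trans ?_
    gcongr
    exact hgR _
  have hb : Tendsto u' atTop (𝓝 b) := by
    have hexp : Tendsto (fun x => Real.exp (-c * x) / c * (2 * (m + 1).toReal)) atTop (𝓝 0) := by
      have h := Real.tendsto_exp_atBot.comp
        (tendsto_id.const_mul_atTop_of_neg (neg_lt_zero.2 hc))
      simpa using (h.div_const c).mul_const (2 * (m + 1).toReal)
    have hsq := squeeze_zero (fun x => sq_nonneg _) hdecay hexp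
    have hn : Tendsto (fun x => ‖b - u' x‖) atTop (𝓝 0) := by
      simpa [Real.sqrt_sq (norm_nonneg _)] using hsq.sqrt
    refine tendsto_iff_norm_sub_tendsto_zero.2 (hn.congr fun x => norm_sub_rev _ _)
  have hu' : u' ∈ admissible W b := by
    refine ⟨memH1Loc_primitive hL p, continuous_primitive hL.locallyIntegrable p, hb, ?_, ?_⟩
    · simpa [u'] using hp
    · exact fun x hx => ge_of_tendsto' (hWpt x) fun k => (hu (φ k)).2.2.2.2 x hx
  have hkin : ENNReal.ofReal (1 / 2 * ‖g'‖ ^ 2) ≤ ENNReal.ofReal (1 / 2 * r ^ 2) := by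
    have := norm_le_of_tendsto_inner hgw hgr
    gcongr
  have hsub : Tendsto (fun k => ENNReal.ofReal (1 / 2 * ‖g (φ k)‖ ^ 2)) atTop
      (𝓝 (ENNReal.ofReal (1 / 2 * r ^ 2))) :=
    ENNReal.tendsto_ofReal ((hgr.pow 2).const_mul _)
  have hlimφ := hlim.comp hφ.tendsto_atTop
  have hrm : ENNReal.ofReal (1 / 2 * r ^ 2) ≤ m :=
    le_of_tendsto_of_tendsto' hsub hlimφ fun k => le_self_add.trans (hE (φ k)).ge
  -- Total and kinetic energies converge to finite limits, so the potential energies converge to the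
  -- difference; Fatou then bounds the potential energy of the limit.
  have hpotlim : Tendsto (fun k => ∫⁻ x, ENNReal.ofReal (potential W c M (u (φ k)) x)) atTop
      (𝓝 (m - ENNReal.ofReal (1 / 2 * r ^ 2))) := by
    refine (ENNReal.Tendsto.sub hlimφ hsub (Or.inl hmtop.ne)).congr fun k => ?_
    simp only [Function.comp_apply, hE]
    exact ENNReal.add_sub_cancel_left ENNReal.ofReal_ne_top
  have hpot : ∫⁻ x, ENNReal.ofReal (potential W c M u' x) ≤
      m - ENNReal.ofReal (1 / 2 * r ^ 2) := by
    rw [← hpotlim.liminf_eq]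
    refine le_trans (lintegral_mono fun x => ?_) (lintegral_liminf_le' fun k =>
      (aestronglyMeasurable_potential hW.continuous hc M
        (hu (φ k)).2.1).aemeasurable.ennreal_ofReal)
    have h : Tendsto (fun k => ENNReal.ofReal (potential W c M (u (φ k)) x)) atTop
        (𝓝 (ENNReal.ofReal (potential W c M u' x))) :=
      ENNReal.tendsto_ofReal (((hWpt x).const_mul _).add_const _)
    exact h.liminf_eq.ge
  have hmin : shiftedEnergy W c M u' ≤ m := by
    rw [shiftedEnergy_eq hM hWM hu'.2.2.2.2 hwd.weakDeriv_ae_eq]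
    exact (add_le_add hkin hpot).trans (add_tsub_cancel_of_le hrm).le
  exact ⟨u', hu', hmin.trans_lt hmtop, fun v hv => hmin.trans (hmle v hv)⟩

end TravelingWave

end

/-- For every `c > 0` the functional `J(c, ·)` is well defined on `𝒜` with values in `(-∞, ∞]`
(its negative part is integrable), and it attains its infimum `γ(c)` over `𝒜`, with finite value,
at some `u ∈ 𝒜`. -/
theorem theorem2p3 (n : ℕ) (W : TravelingWave.Vec n → ℝ) (b : TravelingWave.Vec n)
    (hW : TravelingWave.Assumption W b) (c : ℝ) (hc : 0 < c) :
    (∀ v ∈ TravelingWave.admissible W b, TravelingWave.negEnergy W c v < ⊤) ∧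
    ∃ u ∈ TravelingWave.admissible W b,
      Integrable (TravelingWave.energyDensity W c u) ∧
      TravelingWave.J W c u = TravelingWave.minEnergy W b c := by
  obtain ⟨M, hM, hWM⟩ := hW.exists_lower_bound
  refine ⟨fun v hv => TravelingWave.negEnergy_lt_top hc hM hWM hv.2.2.2.2, ?_⟩
  obtain ⟨u, hu, hfin, hmin⟩ := TravelingWave.exists_isMinOn_shiftedEnergy hW hc hM hWM
  refine ⟨u, hu, TravelingWave.integrable_energyDensity hW.continuous hc hM hWM hu hfin,
    le_antisymm (le_iInf₂ fun v hv => ?_) (iInf₂_le u hu)⟩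
  -- The same finite constant is subtracted for `u` and `v`, so the order of the shifted energies
  -- carries over to `J`.
  rw [TravelingWave.J_eq hW.continuous hc hM hWM hu, TravelingWave.J_eq hW.continuous hc hM hWM hv]
  exact EReal.sub_le_sub (EReal.coe_ennreal_le_coe_ennreal_iff.2 (hmin v hv)) le_rfl
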